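/- **Conventions.** Let $\mathbf C=\{0,1\}^{\mathbb N}$ and write $S{\upharpoonright}n$ for the $n$-bit prefix of $S\in\mathbf C$. A *martingale* is a function $d:\{0,1\}^*\to[0,\infty)$ with $d(w)=\frac{d(w0)+d(w1)}2$ for all $w$. It is a *$\#\mathrm P$-martingale* if there are $f\in\#\mathrm P$ (a function counting the accepting computation paths of a polynomial-time probabilistic Turing machine) and $g\in\mathrm{FP}$, with $g(w,r)$ always a power of $2$, such that $\left|d(w)-\frac{f(w,r)}{g(w,r)}\right|\le 2^{-r}$ for all $w\in\{0,1\}^*$ and $r\in\mathbb N$, where $r$ is encoded in unary. For $s>0$, $d$ *$s$-succeeds* (respectively *$s$-strongly succeeds*) on $S$ if $d(S{\upharpoonright}n)\ge 2^{(1-s)n}$ for infinitely many $n$ (respectively for all but finitely many $n$); it $0$-succeeds ($0$-strongly succeeds) on $S$ if it $s$-succeeds ($s$-strongly succeeds) on $S$ for every $s>0$. For $X\subseteq\mathbf C$, $\dim_{\#\mathrm P}(X)$ (respectively $\mathrm{Dim}_{\#\mathrm P}(X)$) is the infimum of all $s\ge 0$ for which some $\#\mathrm P$-martingale $s$-succeeds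 (respectively $s$-strongly succeeds) on every member of $X$. Let $U$ be a deterministic multitape Turing machine. For $t:\mathbb N\to\mathbb N$ let $K^t(x)$ be the length of a shortest program $\pi\in\{0,1\}^*$ such that $U$ on input $\pi$ prints $x$ in at most $t(|x|)$ steps ($\infty$ if there is none). With $p$ ranging over the polynomials with coefficients in $\mathbb N$, and suprema taken in $[0,\infty]$, put $$\mathcal K_{\mathrm{poly}}(X)=\inf_{p}\ \sup_{S\in X}\ \liminf_{n\to\infty}\frac{K^p(S{\upharpoonright}n)}n,\qquad \mathcal K^{\mathrm{str}}_{\mathrm{poly}}(X)=\inf_{p}\ \sup_{S\in X}\ \limsup_{n\to\infty}\frac{K^p(S{\upharpoonright}n)}n .$$ When $U$ is an efficient universal machine these are the polynomial-time Kolmogorov complexity rate and strong rate of $X$. **Theorem.** For every deterministic Turing machine $U$ (in particular for every universal one) and every class $X\subseteq\mathbf C$, $$\dim_{\#\mathrm P}(X)\le \mathcal K_{\mathrm{poly}}(X)\qquad\text{and}\qquad \mathrm{Dim}_{\#\mathrm P}(X)\le \mathcal K^{\mathrm{str}}_{\mathrm{poly}}(X).$$ -/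

import Mathlib

open Filter
open scoped NNReal ENNReal

namespace CountingDim

/-- Binary strings. -/
abbrev Str := List Bool

/-- One instruction of a multitape probabilistic Turing machine with state set `Q`, tape alphabet
`Γ` and tapes indexed by `ι`: halt and accept, halt and reject, write a symbol on every tape, move
every head (by at most one cell) and change the state, or toss a coin to choose the next state. -/
inductive Instr (Q Γ ι : Type) : Type
  | accept : Instr Q Γ ι
  | reject : Instr Q Γ ι
  | act (q : Q) (a : ι → Γ × Option Turing.Dir) : Instr Q Γ ι
  | toss (q₀ q₁ : Q) : Instr Q Γ ι

/-- Multitape probabilistic Turing machines: finite sets of states, symbols and tapes; the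
instruction performed depends on the state and on the scanned symbols. The blank symbol is
`default`; `bit` embeds the input/output alphabet `{0,1}` in the tape alphabet. -/
structure PTM where
  Q : Type
  Γ : Type
  ι : Type
  [finQ : Finite Q]
  [finΓ : Finite Γ]
  [finι : Finite ι]
  [blank : Inhabited Γ]
  [decι : DecidableEq ι]
  bit : Bool → Γ
  bit_injective : Function.Injective bit
  bit_ne_blank : ∀ b, bit b ≠ default
  inputTape : ι
  outputTape : ι
  start : Q
  instr : Q → (ι → Γ) → Instr Q Γ ι

attribute [instance] PTM.finQ PTM.finΓ PTM.finι PTM.blank PTM.decι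

namespace PTM

variable (M : PTM)

/-- Configurations: a state and the tapes (with their heads). -/
structure Cfg where
  state : M.Q
  tape : M.ι → Turing.Tape M.Γ

variable {M}

/-- The instruction that is about to be performed. -/
def Cfg.cur (c : M.Cfg) : Instr M.Q M.Γ M.ι :=
  M.instr c.state fun i => (c.tape i).head

/-- Write a symbol, then move the head or leave it in place. -/
def writeMove {Γ : Type} [Inhabited Γ] (T : Turing.Tape Γ) : Γ × Option Turing.Dir → Turing.Tape Γ
  | (a, none) => T.write a
  | (a, some d) => (T.write a).move d

/-- The successors of a configuration, one for each outcome of the coin if a coin is tossed. -/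
def Cfg.next (c : M.Cfg) : List M.Cfg :=
  match c.cur with
  | .accept => []
  | .reject => []
  | .act q a => [⟨q, fun i => writeMove (c.tape i) (a i)⟩]
  | .toss q₀ q₁ => [⟨q₀, c.tape⟩, ⟨q₁, c.tape⟩]

/-- The machine has halted and accepted. -/
def Cfg.Accepting (c : M.Cfg) : Prop := c.cur = .accept

/-- The machine has halted. -/
def Cfg.Halted (c : M.Cfg) : Prop := c.cur = .accept ∨ c.cur = .reject

/-- Every computation path from `c` halts within `t` steps. -/
def HaltsWithin : ℕ → M.Cfg → Prop
  | 0, c => c.Halted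
  | t + 1, c => ∀ c' ∈ c.next, HaltsWithin t c'

open Classical in
/-- The number of computation paths from `c` that accept within `t` steps. -/
noncomputable def acceptingPaths : ℕ → M.Cfg → ℕ
  | 0, c => if c.Accepting then 1 else 0
  | t + 1, c => if c.Accepting then 1 else (c.next.map (acceptingPaths t)).sum

/-- The output tape shows `y`: the string from the head to the right, up to the first blank. -/
def Cfg.Shows (c : M.Cfg) (y : Str) : Prop :=
  (∀ (i : ℕ) (h : i < y.length), (c.tape M.outputTape).nth (i : ℤ) = M.bit y[i]) ∧
    (c.tape M.outputTape).nth (y.length : ℤ) = default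

/-- Some computation path from `c` halts within `t` steps with output `y`; used only for
deterministic machines, where there is exactly one path. -/
def PrintsWithin : ℕ → M.Cfg → Str → Prop
  | 0, c, y => c.Halted ∧ c.Shows y
  | t + 1, c, y => (c.Halted ∧ c.Shows y) ∨ ∃ c' ∈ c.next, PrintsWithin t c' y

variable (M)

/-- The initial configuration: the input on the input tape, with the head on its first symbol; all
other cells are blank. -/
def initial (x : Str) : M.Cfg where
  state := M.start
  tape i := if i = M.inputTape then Turing.Tape.mk₁ (x.map M.bit) else Turing.Tape.mk₁ []

/-- A deterministic machine never tosses a coin. -/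
def Deterministic : Prop := ∀ q s q₀ q₁, M.instr q s ≠ .toss q₀ q₁

end PTM

/-- The class #P: the functions that count the accepting computation paths of polynomial-time
probabilistic Turing machines. -/
def SharpP (f : Str → ℕ) : Prop :=
  ∃ (M : PTM) (p : Polynomial ℕ), ∀ x : Str,
    PTM.HaltsWithin (p.eval x.length) (M.initial x) ∧
      f x = PTM.acceptingPaths (p.eval x.length) (M.initial x)

/-- The class FP of string functions computed by deterministic polynomial-time machines. -/
def FP (F : Str → Str) : Prop :=
  ∃ (M : PTM) (p : Polynomial ℕ), M.Deterministic ∧ ∀ x : Str,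
    PTM.PrintsWithin (p.eval x.length) (M.initial x) (F x)

/-- Binary notation of a natural number, most significant bit first. -/
def binary (n : ℕ) : Str := n.bits.reverse

/-- The code `1^r 0 w` of a pair of a string `w` and a number `r` in unary. -/
def pairUnary (w : Str) (r : ℕ) : Str := List.replicate r true ++ false :: w

/-- Martingales on binary strings. -/
def IsMartingale (d : Str → ℝ) : Prop :=
  ∀ w, 0 ≤ d w ∧ d w = (d (w ++ [false]) + d (w ++ [true])) / 2

/-- A #P-martingale is a martingale that is approximated to within `2^(-r)` by the ratio of a #P
function and an FP function whose values are powers of two; the precision `r` is in unary. -/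
def IsSharpPMartingale (d : Str → ℝ) : Prop :=
  IsMartingale d ∧ ∃ f g : Str → ℕ, SharpP f ∧ FP (fun x => binary (g x)) ∧
    ∀ (w : Str) (r : ℕ), (∃ m : ℕ, g (pairUnary w r) = 2 ^ m) ∧
      |d w - (f (pairUnary w r) : ℝ) / (g (pairUnary w r) : ℝ)| ≤ (2 : ℝ)⁻¹ ^ r

/-- The prefix of length `n` of an infinite binary sequence. -/
def pre (S : ℕ → Bool) (n : ℕ) : Str := (List.range n).map S

/-- The martingale `d` `s`-succeeds on `S`. -/
def Succeeds (d : Str → ℝ) (s : ℝ) (S : ℕ → Bool) : Prop :=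
  (0 < s ∧ ∃ᶠ n : ℕ in atTop, (2 : ℝ) ^ ((1 - s) * (n : ℝ)) ≤ d (pre S n)) ∨
    (s = 0 ∧ ∀ t : ℝ, 0 < t → ∃ᶠ n : ℕ in atTop, (2 : ℝ) ^ ((1 - t) * (n : ℝ)) ≤ d (pre S n))

/-- The martingale `d` `s`-strongly succeeds on `S`. -/
def StronglySucceeds (d : Str → ℝ) (s : ℝ) (S : ℕ → Bool) : Prop :=
  (0 < s ∧ ∀ᶠ n : ℕ in atTop, (2 : ℝ) ^ ((1 - s) * (n : ℝ)) ≤ d (pre S n)) ∨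
    (s = 0 ∧ ∀ t : ℝ, 0 < t → ∀ᶠ n : ℕ in atTop, (2 : ℝ) ^ ((1 - t) * (n : ℝ)) ≤ d (pre S n))

/-- The #P-dimension of a class of infinite binary sequences. -/
noncomputable def sharpPDim (X : Set (ℕ → Bool)) : ℝ≥0∞ :=
  ⨅ (s : ℝ≥0) (_ : ∃ d, IsSharpPMartingale d ∧ ∀ S ∈ X, Succeeds d s S), (s : ℝ≥0∞)

/-- The #P-strong dimension of a class of infinite binary sequences. -/
noncomputable def sharpPStrongDim (X : Set (ℕ → Bool)) : ℝ≥0∞ :=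
  ⨅ (s : ℝ≥0) (_ : ∃ d, IsSharpPMartingale d ∧ ∀ S ∈ X, StronglySucceeds d s S), (s : ℝ≥0∞)

/-- Time-bounded Kolmogorov complexity `K^t(x)` with respect to the machine `U`: the length of a
shortest program `π` such that `U` on input `π` prints `x` in at most `t(|x|)` steps (`⊤` if there
is none). -/
noncomputable def timeK (U : PTM) (t : ℕ → ℕ) (x : Str) : ℕ∞ :=
  ⨅ (π : Str) (_ : PTM.PrintsWithin (t x.length) (U.initial π) x), (π.length : ℕ∞)

/-- The polynomial-time Kolmogorov complexity rate of a class `X`. -/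
noncomputable def polyKRate (U : PTM) (X : Set (ℕ → Bool)) : ℝ≥0∞ :=
  ⨅ p : Polynomial ℕ, ⨆ S ∈ X,
    liminf (fun n : ℕ => ((timeK U (fun m => p.eval m) (pre S n) : ℕ∞) : ℝ≥0∞) / (n : ℝ≥0∞)) atTop

/-- The polynomial-time strong Kolmogorov complexity rate of a class `X`. -/
noncomputable def polyKStrongRate (U : PTM) (X : Set (ℕ → Bool)) : ℝ≥0∞ :=
  ⨅ p : Polynomial ℕ, ⨆ S ∈ X,
    limsup (fun n : ℕ => ((timeK U (fun m => p.eval m) (pre S n) : ℕ∞) : ℝ≥0∞) / (n : ℝ≥0∞)) atTop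

end CountingDim

/-! Betting everything on the output of `U` on a program `π` is a martingale, and averaging over
random programs gives a string of length `n` with a program of length `l` capital about `2^(n-l)`.
Such averages are path counts divided by a power of two. The difficulty is that the martingale
identity must hold exactly, so neither the law of the program nor the running time may depend on
`|w|`, although the allowed time is `p(|w|)`.

The remedy is to draw the scale at random too. A guess is a number `j`, of weight `2^-(j+1)`, and `A
* j` fair coins coding a program, on which `U` runs for `(j + 2)^c - 1` steps. Each guess fixes an
output tape independent of `w`, so `capital`, the sum over all guesses, is a martingale
(`isMartingale_capital`). The input `1^r 0 w` has `r + 1 + |w|` symbols and lets a machine try all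
smaller `j`; since the capital of a guess is at most `2^|w|`, the neglected tail is below `2^-r`
(`isSharpPMartingale_capital`).

On the machine side, a factor 2 in the capital is a coin whose outcomes are treated alike, and idle
coins give all guesses the common denominator `2^((A+1)|x|)` (`sharpP_liveCount`,
`liveCount_div_eq`).

If `|x| = n` and `x` has a program shorter than `(A/B) n` running in time `p(n)`, the scale `j = n /
B + 1` alone yields capital `2^(n - (A+1)j - 1)` (`pow_le_capital`). With `A/B` just above `k` and
`B` large, the loss is at most `s n` for any given `s > k` and large `n`
(`exists_sharpPMartingale_rate`). -/

namespace CountingDim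

open Turing

namespace PTM

/-! ### Counting accepting paths -/

variable {M : PTM}

/-- All paths from `c` halt within `t` steps, and exactly `k` of them accept. -/
def Counts (t : ℕ) (c : M.Cfg) (k : ℕ) : Prop :=
  HaltsWithin t c ∧ acceptingPaths t c = k

theorem Cfg.next_of_halted {c : M.Cfg} (h : c.Halted) : c.next = [] := by
  rcases h with h | h <;> simp [Cfg.next, h]

theorem acceptingPaths_zero_eq (c : M.Cfg) (h : c.Halted) (t : ℕ) :
    acceptingPaths t c = acceptingPaths 0 c := by
  cases t <;> simp [acceptingPaths, Cfg.next_of_halted h]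

theorem Counts.succ {t : ℕ} {c : M.Cfg} {k : ℕ} (h : Counts t c k) : Counts (t + 1) c k := by
  induction t generalizing c k with
  | zero =>
    obtain ⟨h₁, h₂⟩ := h
    refine ⟨?_, (acceptingPaths_zero_eq c h₁ _).trans h₂⟩
    simp [HaltsWithin, Cfg.next_of_halted (c := c) h₁]
  | succ t ih =>
    obtain ⟨h₁, h₂⟩ := h
    have key : ∀ c' ∈ c.next, Counts (t + 1) c' (acceptingPaths t c') :=
      fun c' hc' => ih ⟨h₁ c' hc', rfl⟩
    refine ⟨fun c' hc' => (key c' hc').1, ?_⟩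
    rw [← h₂]
    have : c.next.map (acceptingPaths (t + 1)) = c.next.map (acceptingPaths t) :=
      List.map_congr_left fun c' hc' => (key c' hc').2
    simp only [acceptingPaths] at this ⊢
    rw [this]

theorem Counts.mono {t t' : ℕ} {c : M.Cfg} {k : ℕ} (h : Counts t c k) (ht : t ≤ t') :
    Counts t' c k := by
  induction t', ht using Nat.le_induction with
  | base => exact h
  | succ _ _ ih => exact ih.succ

theorem counts_of_accept {c : M.Cfg} (h : c.cur = .accept) (t : ℕ) : Counts t c 1 :=
  Counts.mono (t := 0) ⟨Or.inl h, by simp [acceptingPaths, Cfg.Accepting, h]⟩ (Nat.zero_le _)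

theorem counts_of_reject {c : M.Cfg} (h : c.cur = .reject) (t : ℕ) : Counts t c 0 :=
  Counts.mono (t := 0) ⟨Or.inr h, by simp [acceptingPaths, Cfg.Accepting, h]⟩ (Nat.zero_le _)

theorem counts_of_act {c : M.Cfg} {q : M.Q} {a : M.ι → M.Γ × Option Dir} (h : c.cur = .act q a)
    {t k : ℕ} (hc : Counts t ⟨q, fun i => writeMove (c.tape i) (a i)⟩ k) :
    Counts (t + 1) c k := by
  have hn : c.next = [⟨q, fun i => writeMove (c.tape i) (a i)⟩] := by simp [Cfg.next, h]
  refine ⟨fun c' hc' => ?_, ?_⟩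
  · rw [hn, List.mem_singleton] at hc'
    exact hc' ▸ hc.1
  · simp [acceptingPaths, Cfg.Accepting, h, hn, hc.2]

theorem counts_of_toss {c : M.Cfg} {q₀ q₁ : M.Q} (h : c.cur = .toss q₀ q₁)
    {t k₀ k₁ : ℕ} (h₀ : Counts t ⟨q₀, c.tape⟩ k₀) (h₁ : Counts t ⟨q₁, c.tape⟩ k₁) :
    Counts (t + 1) c (k₀ + k₁) := by
  have hn : c.next = [⟨q₀, c.tape⟩, ⟨q₁, c.tape⟩] := by simp [Cfg.next, h]
  refine ⟨fun c' hc' => ?_, ?_⟩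
  · rw [hn, List.mem_cons, List.mem_singleton] at hc'
    rcases hc' with rfl | rfl
    exacts [h₀.1, h₁.1]
  · simp [acceptingPaths, Cfg.Accepting, h, hn, h₀.2, h₁.2]

/-! ### Elementary tape operations and printing. -/

@[simp]
theorem writeMove_self {Γ : Type} [Inhabited Γ] (T : Tape Γ) : writeMove T (T.head, none) = T :=
  T.write_self

@[simp]
theorem writeMove_self_some {Γ : Type} [Inhabited Γ] (T : Tape Γ) (d : Dir) :
    writeMove T (T.head, some d) = T.move d := by
  simp [writeMove]

theorem move_left_mk₁_nil {Γ : Type} [Inhabited Γ] : (Tape.mk₁ ([] : List Γ)).move .left =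
    Tape.mk₁ [] := by
  simp only [Tape.mk₁, Tape.mk₂, Tape.move_left_mk', ListBlank.tail_mk, ListBlank.head_mk,
    ListBlank.cons_mk, List.tail_nil, List.headI_nil]
  congr 1
  ext i
  cases i <;> simp [ListBlank.nth_mk]

/-- Writing a symbol in the blank cell in front of a word, then moving left. -/
theorem writeMove_left_mk₁ {Γ : Type} [Inhabited Γ] (l : List Γ) (a : Γ) :
    writeMove ((Tape.mk₁ l).move .left) (a, some .left) = (Tape.mk₁ (a :: l)).move .left := by
  simp [writeMove, Tape.mk₁, Tape.mk₂]

theorem write_mk₁_move_left {Γ : Type} [Inhabited Γ] (l : List Γ) (a : Γ) :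
    ((Tape.mk₁ l).move .left).write a = Tape.mk₁ (a :: l) := by
  simp [Tape.mk₁, Tape.mk₂]

theorem mk₁_map_nth (M : PTM) (l : Str) : (∀ (i : ℕ) (h : i < l.length),
    (Tape.mk₁ (l.map M.bit)).nth (i : ℤ) = M.bit l[i]) ∧
    (Tape.mk₁ (l.map M.bit)).nth (l.length : ℤ) = default := by
  constructor
  · intro i h
    simp [Tape.mk₁, Tape.mk₂, ListBlank.nth_mk, List.getI_eq_getElem, h]
  · simp [Tape.mk₁, Tape.mk₂, ListBlank.nth_mk, List.getI_eq_default]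

theorem printsWithin_of_act {c : M.Cfg} {q : M.Q} {a : M.ι → M.Γ × Option Dir}
    (h : c.cur = .act q a) {t : ℕ} {y : Str}
    (hc : PrintsWithin t ⟨q, fun i => writeMove (c.tape i) (a i)⟩ y) :
    PrintsWithin (t + 1) c y :=
  Or.inr ⟨_, by simp [Cfg.next, h], hc⟩

theorem printsWithin_of_halted {c : M.Cfg} (h : c.Halted) {y : Str} (hy : c.Shows y) (t : ℕ) :
    PrintsWithin t c y := by
  cases t
  exacts [⟨h, hy⟩, Or.inl ⟨h, hy⟩]

/-! ### Running a deterministic machine for a fixed number of steps -/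

/-- One step of a deterministic machine, staying put when it has halted. -/
def step (c : M.Cfg) : M.Cfg := c.next.headD c

/-- A halted configuration is a fixed point of `step`, so its output persists. Hence `U` may be run
for a length of time that depends on the guess alone. -/
theorem shows_iterate_step (hM : M.Deterministic) {t : ℕ} {c : M.Cfg} {y : Str}
    (h : PrintsWithin t c y) {n : ℕ} (hn : t ≤ n) : (step^[n] c).Shows y := by
  have halted : ∀ {c : M.Cfg}, c.Halted → c.Shows y → ∀ n, (step^[n] c).Shows y := by
    intro c h₁ h₂ n
    have : step c = c := by simp [step, Cfg.next_of_halted h₁]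
    rwa [Function.iterate_fixed this]
  induction t generalizing c n with
  | zero => exact halted h.1 h.2 n
  | succ t ih =>
    rcases h with h | ⟨c', hc', h⟩
    · exact halted h.1 h.2 n
    · obtain ⟨n, rfl⟩ : ∃ m, n = m + 1 := ⟨n - 1, by omega⟩
      rw [Function.iterate_succ_apply]
      have : step c = c' := by
        unfold step
        unfold Cfg.next at hc' ⊢
        match hcur : c.cur with
        | .accept => simp [hcur] at hc'
        | .reject => simp [hcur] at hc'
        | .act q a =>
          simp only [hcur, List.mem_singleton] at hc'
          simp [hc']
        | .toss q₀ q₁ => exact absurd hcur (hM _ _ _ _)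
      rw [this]
      exact ih h (by omega)

end PTM

/-! ### Powers of two in binary -/

theorem binary_two_pow (m : ℕ) : binary (2 ^ m) = true :: List.replicate m false := by
  have : (2 ^ m).bits = List.replicate m false ++ [true] := by
    induction m with
    | zero => simp
    | succ m ih =>
      rw [pow_succ, mul_comm, Nat.bit0_bits _ (by positivity), ih]
      simp [List.replicate_succ]
  simp [binary, this]

/-- The states of a machine that prints `1 0^(k|x|)` on input `x`. -/
inductive PowState (k : ℕ)
  | scan
  | zero (i : Fin (k + 1))
  | done

instance (k : ℕ) : Finite (PowState k) :=
  Finite.of_surjective (fun o : Option (Option (Fin (k + 1))) => match o with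
    | none => .scan
    | some none => .done
    | some (some i) => .zero i) fun q => by
    cases q with
    | scan => exact ⟨none, rfl⟩
    | zero i => exact ⟨some (some i), rfl⟩
    | done => exact ⟨some none, rfl⟩

/-- A machine that prints `1 0^(k|x|)` on input `x`: its output is written from right to left. -/
def powMachine (k : ℕ) : PTM where
  Q := PowState k
  Γ := Option Bool
  ι := Bool
  blank := ⟨none⟩
  bit := some
  bit_injective := Option.some_injective _
  bit_ne_blank b := by simp [default]
  inputTape := false
  outputTape := true
  start := .scan
  instr q s := match q with
    | .scan => match s false with
      | none => .act .done fun b => bif b then (some true, none) else (s b, none)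
      | some _ => .act (.zero (Fin.last k)) fun b => (s b, none)
    | .zero ⟨0, _⟩ => .act .scan fun b => bif b then (s b, none) else (s b, some .right)
    | .zero ⟨i + 1, h⟩ => .act (.zero ⟨i, by omega⟩) fun b =>
        bif b then (some false, some .left) else (s b, none)
    | .done => .accept

/-- The two tapes of `powMachine`. -/
def powTapes (I O : Tape (Option Bool)) : Bool → Tape (Option Bool) := fun b => bif b then O else I

theorem powMachine_zero (k : ℕ) {t : ℕ} {y : Str} (i : ℕ) (hi : i < k + 1) (l : Str)
    (I : Tape (Option Bool))
    (h : PTM.PrintsWithin (M := powMachine k) t ⟨.scan, powTapes (I.move .right)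
      ((Tape.mk₁ ((List.replicate i false ++ l).map some)).move .left)⟩ y) :
    PTM.PrintsWithin (M := powMachine k) (t + i + 1)
      ⟨.zero ⟨i, hi⟩, powTapes I ((Tape.mk₁ (l.map some)).move .left)⟩ y := by
  induction i generalizing l with
  | zero =>
    refine PTM.printsWithin_of_act (M := powMachine k) rfl ?_
    convert h using 1
    refine congrArg (PTM.Cfg.mk (M := powMachine k) _) (funext fun b => ?_)
    cases b
    · exact PTM.writeMove_self_some I .right
    · exact PTM.writeMove_self _
  | succ i ih =>
    refine PTM.printsWithin_of_act (M := powMachine k) (t := t + i + 1) rfl ?_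
    have := ih (by omega) (false :: l) (by
      convert h using 6
      rw [List.replicate_succ', List.append_assoc]; rfl)
    convert this using 1
    refine congrArg (PTM.Cfg.mk (M := powMachine k) _) (funext fun b => ?_)
    cases b
    · exact PTM.writeMove_self I
    · exact PTM.writeMove_left_mk₁ _ _

/-- The word `l` collects the zeros written so far. The output head waits on the blank in front of
them, where the leading one is written when the input is exhausted. -/
theorem powMachine_scan (k : ℕ) (x l : Str) (L : ListBlank (Option Bool)) :
    PTM.PrintsWithin (M := powMachine k) ((k + 2) * x.length + 1)
      ⟨.scan, powTapes (Tape.mk' L (ListBlank.mk (x.map some)))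
        ((Tape.mk₁ (l.map some)).move .left)⟩
      (true :: (List.replicate (k * x.length) false ++ l)) := by
  induction x generalizing l L with
  | nil =>
    refine PTM.printsWithin_of_act (M := powMachine k) rfl ?_
    refine PTM.printsWithin_of_halted (Or.inl rfl) ?_ _
    have := PTM.mk₁_map_nth (powMachine k) (true :: l)
    have hT : PTM.writeMove ((Tape.mk₁ (l.map some)).move .left) (some true, none) =
        Tape.mk₁ ((true :: l).map (powMachine k).bit) := PTM.write_mk₁_move_left _ _
    rw [← hT] at this
    exact this
  | cons b x ih =>
    refine PTM.printsWithin_of_act (M := powMachine k) (t := (k + 2) * (x.length + 1)) rfl ?_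
    have := powMachine_zero k (t := (k + 2) * x.length + 1)
      (y := true :: (List.replicate (k * (b :: x).length) false ++ l)) k (by omega) l
      (Tape.mk' L (ListBlank.mk ((b :: x).map some))) (by
        have := ih (List.replicate k false ++ l) (L.cons (some b))
        rw [← List.append_assoc, List.replicate_append_replicate] at this
        simpa [mul_add] using this)
    convert this using 1
    · ring
    · exact congrArg (PTM.Cfg.mk (M := powMachine k) _) (funext fun b => PTM.writeMove_self _)

theorem fp_two_pow (k : ℕ) : FP fun x => binary (2 ^ (k * x.length)) := by
  refine ⟨powMachine k, Polynomial.C (k + 2) * Polynomial.X + 1, ?_, fun x => ?_⟩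
  · intro q s q₀ q₁ h
    match q with
    | .scan =>
      cases hs : s false <;> simp [powMachine, hs] at h
    | .zero ⟨0, _⟩ => cases h
    | .zero ⟨i + 1, _⟩ => cases h
    | .done => cases h
  · have := powMachine_scan k x [] (ListBlank.mk [])
    convert this using 1
    · simp
    · unfold PTM.initial
      congr 1
      ext b : 1
      cases b
      · rfl
      · exact PTM.move_left_mk₁_nil.symm
    · simp [binary_two_pow]

/-! ### The counting machine -/

/-- The control states of the counting machine outside the simulation of `U`. -/
inductive Ctl (A : ℕ)
  | init
  | live (m : Bool)
  | mark (m : Bool)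
  | coin (k : Fin (A + 1)) (m : Bool)
  | put (k : Fin (A + 1)) (b : Bool)
  | dummy (k : Fin (A + 1))
  | dead
  | back
  | skip
  | cmp
  | adv

instance (A : ℕ) : Finite (Ctl A) :=
  Finite.of_injective (fun q : Ctl A => match q with
    | .init => ((0, 0, false) : Fin 11 × Fin (A + 1) × Bool)
    | .live m => (1, 0, m)
    | .mark m => (2, 0, m)
    | .coin k m => (3, k, m)
    | .put k b => (4, k, b)
    | .dummy k => (5, k, false)
    | .dead => (6, 0, false)
    | .back => (7, 0, false)
    | .skip => (8, 0, false)
    | .cmp => (9, 0, false)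
    | .adv => (10, 0, false)) fun q q' h => by
    cases q <;> cases q' <;> simp_all

/-- A family indexed by an input tape, work tapes and clock tapes. -/
def fam {α ι κ : Type} (a : α) (w : ι → α) (z : κ → α) : Option (ι ⊕ κ) → α
  | none => a
  | some (.inl i) => w i
  | some (.inr k) => z k

/-! ### Clock tapes as digits of a counter. -/

section Clock

variable (U : PTM) {c : ℕ}

/-- The head of a clock tape that moves right (`d = true`) or left scans the last cell. -/
def AtEnd (d : Bool) (a : U.Γ) : Prop := if d then a = default else a = U.bit false

/-- All clock tapes before the `k`-th one are at their ends. -/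
def Carry (dir : Fin c → Bool) (z : Fin c → U.Γ) (k : Fin c) : Prop :=
  ∀ l < k, AtEnd U (dir l) (z l)

open Classical in
/-- The directions after a tick of the clock, a reflected Gray code. -/
noncomputable def tickDir (dir : Fin c → Bool) (z : Fin c → U.Γ) (k : Fin c) : Bool :=
  if Carry U dir z k ∧ AtEnd U (dir k) (z k) then !dir k else dir k

open Classical in
/-- The head moves in a tick of the clock. -/
noncomputable def tickMove (dir : Fin c → Bool) (z : Fin c → U.Γ) (k : Fin c) : Option Dir :=
  if Carry U dir z k ∧ ¬ AtEnd U (dir k) (z k) then some (bif dir k then .right else .left)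
  else none

end Clock

section Machine

variable (U : PTM) (A c : ℕ)

/-- Leave the scanned symbols and the heads as they are. -/
def keep {ι Γ : Type} (w : ι → Γ) : ι → Γ × Option Dir := fun i => (w i, none)

/-- Keep all symbols, and move one of the heads. -/
def moveOnly {ι Γ : Type} [DecidableEq ι] (j : ι) (d : Dir) (w : ι → Γ) : ι → Γ × Option Dir :=
  fun i => (w i, if i = j then some d else none)

open Classical in
/-- The instructions of the counting machine. On input `x` it tosses `A + 1` coins for each symbol
of `x`, which choose a number `j` and a program, simulates `U` on this program for
`(j + 2) ^ c - 1` steps, and compares the output with the word `w` that is encoded in `x`. -/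
noncomputable def countInstr (a : U.Γ) (w : U.ι → U.Γ) (z : Fin c → U.Γ) :
    Ctl A ⊕ U.Q × (Fin c → Bool) →
      Instr (Ctl A ⊕ U.Q × (Fin c → Bool)) U.Γ (Option (U.ι ⊕ Fin c))
  | .inl .init =>
      .act (.inl (.live false)) (fam (a, none) (keep w) fun _ => (U.bit false, some .right))
  | .inl (.live m) =>
      if a = default then .reject else .toss (.inl (.dummy (Fin.last A))) (.inl (.mark m))
  | .inl (.mark m) =>
      .act (.inl (.coin (Fin.last A) m)) (fam (a, none) (keep w) fun _ => (U.bit true, some .right))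
  | .inl (.coin ⟨0, _⟩ m) => .act (.inl (.live m)) (fam (a, some .right) (keep w) (keep z))
  | .inl (.coin ⟨k + 1, h⟩ false) =>
      .toss (.inl (.coin ⟨k, by omega⟩ false)) (.inl (.coin ⟨k, by omega⟩ true))
  | .inl (.coin ⟨k + 1, h⟩ true) =>
      .toss (.inl (.put ⟨k, by omega⟩ false)) (.inl (.put ⟨k, by omega⟩ true))
  | .inl (.put k b) =>
      .act (.inl (.coin k true)) (fam (a, none)
        (fun i => if i = U.inputTape then (U.bit b, some .left) else (w i, none)) (keep z))
  | .inl (.dummy ⟨0, _⟩) => .act (.inl .dead) (fam (a, some .right) (keep w) (keep z))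
  | .inl (.dummy ⟨k + 1, h⟩) =>
      .toss (.inl (.dummy ⟨k, by omega⟩)) (.inl (.dummy ⟨k, by omega⟩))
  | .inl .dead =>
      if a = default then .act (.inl .back) (fam (a, some .left) (keep w) (keep z))
      else .toss (.inl (.dummy (Fin.last A))) (.inl (.dummy (Fin.last A)))
  | .inl .back =>
      if a = default then .act (.inl .skip) (fam (a, some .right) (keep w) (keep z))
      else .act (.inl .back) (fam (a, some .left) (keep w) (keep z))
  | .inl .skip =>
      if a = U.bit true then .act (.inl .skip) (fam (a, some .right) (keep w) (keep z))
      else .act (.inr (U.start, fun _ => false))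
        (fam (a, some .right) (moveOnly U.inputTape .right w) (keep z))
  | .inl .cmp =>
      if a = default then .accept
      else if w U.outputTape = a then .toss (.inl .adv) (.inl .adv)
      else if w U.outputTape = U.bit true ∨ w U.outputTape = U.bit false then .reject
      else .act (.inl .adv) (fam (a, none) (keep w) (keep z))
  | .inl .adv =>
      .act (.inl .cmp) (fam (a, some .right) (moveOnly U.outputTape .right w) (keep z))
  | .inr (q, dir) =>
      if ∀ k, AtEnd U (dir k) (z k) then .act (.inl .cmp) (fam (a, none) (keep w) (keep z))
      else match U.instr q w with
        | .act q' b => .act (.inr (q', tickDir U dir z))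
            (fam (a, none) b fun k => (z k, tickMove U dir z k))
        | _ => .act (.inr (q, tickDir U dir z))
            (fam (a, none) (keep w) fun k => (z k, tickMove U dir z k))

/-- The counting machine. -/
noncomputable def countMachine : PTM where
  Q := Ctl A ⊕ U.Q × (Fin c → Bool)
  Γ := U.Γ
  ι := Option (U.ι ⊕ Fin c)
  bit := U.bit
  bit_injective := U.bit_injective
  bit_ne_blank := U.bit_ne_blank
  inputTape := none
  outputTape := none
  start := .inl .init
  instr q s := countInstr U A c (s none) (fun i => s (some (.inl i))) (fun k => s (some (.inr k))) q

variable {U A c}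

/-- All paths of the counting machine from the given configuration halt within `t` steps, and `n`
of them accept. -/
def MCounts (t : ℕ) (q : Ctl A ⊕ U.Q × (Fin c → Bool)) (I : Tape U.Γ) (W : U.ι → Tape U.Γ)
    (Z : Fin c → Tape U.Γ) (n : ℕ) : Prop :=
  PTM.Counts (M := countMachine U A c) t ⟨q, fam I W Z⟩ n

variable {t n : ℕ} {q q' : Ctl A ⊕ U.Q × (Fin c → Bool)} {I : Tape U.Γ} {W : U.ι → Tape U.Γ}
  {Z : Fin c → Tape U.Γ}

/-! ### Accepting paths of the counting machine, instruction by instruction. -/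

theorem MCounts.mono {t' : ℕ} (h : MCounts t q I W Z n) (ht : t ≤ t') : MCounts t' q I W Z n :=
  PTM.Counts.mono h ht

theorem mcounts_accept
    (h : countInstr U A c I.head (fun i => (W i).head) (fun k => (Z k).head) q = .accept) (t : ℕ) :
    MCounts t q I W Z 1 :=
  PTM.counts_of_accept (M := countMachine U A c) (c := ⟨q, fam I W Z⟩) h t

theorem mcounts_reject
    (h : countInstr U A c I.head (fun i => (W i).head) (fun k => (Z k).head) q = .reject) (t : ℕ) :
    MCounts t q I W Z 0 :=
  PTM.counts_of_reject (M := countMachine U A c) (c := ⟨q, fam I W Z⟩) h t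

theorem mcounts_toss {q₀ q₁ : Ctl A ⊕ U.Q × (Fin c → Bool)} {n₀ n₁ : ℕ}
    (h : countInstr U A c I.head (fun i => (W i).head) (fun k => (Z k).head) q = .toss q₀ q₁)
    (h₀ : MCounts t q₀ I W Z n₀) (h₁ : MCounts t q₁ I W Z n₁) :
    MCounts (t + 1) q I W Z (n₀ + n₁) :=
  PTM.counts_of_toss (M := countMachine U A c) (c := ⟨q, fam I W Z⟩) h h₀ h₁

theorem mcounts_act {a : U.Γ × Option Dir} {w : U.ι → U.Γ × Option Dir}
    {z : Fin c → U.Γ × Option Dir} {I' : Tape U.Γ} {W' : U.ι → Tape U.Γ} {Z' : Fin c → Tape U.Γ}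
    (h : countInstr U A c I.head (fun i => (W i).head) (fun k => (Z k).head) q =
      .act q' (fam a w z))
    (hI : PTM.writeMove I a = I') (hW : ∀ i, PTM.writeMove (W i) (w i) = W' i)
    (hZ : ∀ k, PTM.writeMove (Z k) (z k) = Z' k) (hn : MCounts t q' I' W' Z' n) :
    MCounts (t + 1) q I W Z n := by
  refine PTM.counts_of_act (M := countMachine U A c) (c := ⟨q, fam I W Z⟩) h ?_
  have hT : (fun i => PTM.writeMove (fam I W Z i) (fam a w z i)) = fam I' W' Z' := by
    funext i
    match i with
    | none => exact hI
    | some (.inl i) => exact hW i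
    | some (.inr k) => exact hZ k
  exact (congrArg (fun T => PTM.Counts (M := countMachine U A c) t ⟨q', T⟩ n) hT).mpr hn

theorem writeMove_keep {ι : Type} (T : ι → Tape U.Γ) (i : ι) :
    PTM.writeMove (T i) (keep (fun j => (T j).head) i) = T i :=
  PTM.writeMove_self _

/-! ### Comparing the output with a word -/

open Classical in
/-- The factor by which a cell with content `a` contributes to the capital after a bit `b`. -/
noncomputable def cellWeight (U : PTM) (a : U.Γ) (b : Bool) : ℕ :=
  if a = U.bit b then 2 else if a = U.bit !b then 0 else 1

/-- The capital on `w` of the martingale that bets on the bits on the tape `T`. -/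
noncomputable def weight (U : PTM) (T : Tape U.Γ) : Str → ℕ
  | [] => 1
  | b :: w => cellWeight U T.head b * weight U (T.move .right) w

theorem move_right_mk'_cons {Γ : Type} [Inhabited Γ] (L : ListBlank Γ) (a : Γ) (l : List Γ) :
    (Tape.mk' L (ListBlank.mk (a :: l))).move .right = Tape.mk' (L.cons a) (ListBlank.mk l) := by
  simp

/-- A matching bit tosses a coin with equal outcomes and doubles the count, the opposite bit
rejects, and a cell without a bit leaves the count unchanged. These are the three values of
`cellWeight`. -/
theorem mcounts_cmp (u : Str) (L : ListBlank U.Γ) (W : U.ι → Tape U.Γ) (Z : Fin c → Tape U.Γ) :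
    MCounts (A := A) (2 * u.length) (.inl .cmp) (Tape.mk' L (ListBlank.mk (u.map U.bit))) W Z
      (weight U (W U.outputTape) u) := by
  induction u generalizing L W with
  | nil => exact mcounts_accept (by simp [countInstr]) _
  | cons b u ih =>
    have hadv : MCounts (A := A) (2 * u.length + 1) (.inl .adv)
        (Tape.mk' L (ListBlank.mk ((b :: u).map U.bit))) W Z
        (weight U ((W U.outputTape).move .right) u) := by
      refine mcounts_act (W' := fun i => if i = U.outputTape then (W i).move .right else W i)
        rfl (PTM.writeMove_self_some _ _) (fun i => ?_) (writeMove_keep _) ?_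
      · by_cases h : i = U.outputTape <;> simp [moveOnly, h]
      · rw [List.map_cons, move_right_mk'_cons]
        have := ih (L.cons (U.bit b))
          (fun i => if i = U.outputTape then (W i).move .right else W i)
        rwa [if_pos rfl] at this
    change MCounts (2 * u.length + 1 + 1) _ _ _ _ (cellWeight U (W U.outputTape).head b * _)
    have hb := U.bit_ne_blank b
    unfold cellWeight
    split_ifs with h₁ h₂
    · rw [two_mul (weight U _ _)]
      refine mcounts_toss ?_ hadv hadv
      simp [countInstr, h₁, hb]
    · rw [zero_mul]
      refine mcounts_reject ?_ _
      have h₁' : U.bit (!b) ≠ U.bit b := h₂ ▸ h₁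
      cases b <;> simp_all [countInstr]
    · rw [one_mul]
      refine mcounts_act ?_ (PTM.writeMove_self _) (writeMove_keep _) (writeMove_keep _) hadv
      cases b <;> simp_all [countInstr]

/-! ### The clock -/

/-- A clock tape with `N` marked cells, whose head is in position `p`. -/
def IsClock (U : PTM) (N p : ℕ) (T : Tape U.Γ) : Prop :=
  ∀ i : ℤ, T.nth i = if i + p = 0 then U.bit false else
    if 0 < i + p ∧ i + p < N then U.bit true else default

theorem isClock_one : IsClock U 1 1 (PTM.writeMove (Tape.mk₁ []) (U.bit false, some .right)) := by
  intro i
  have hblank : ∀ i : ℤ, (Tape.mk₁ ([] : List U.Γ)).nth i = default := by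
    rintro ((_ | n) | n)
    · rfl
    · exact ListBlank.nth_mk _ _
    · exact ListBlank.nth_mk _ _
  simp only [PTM.writeMove, Tape.move_right_nth, Tape.write_nth, hblank]
  split_ifs <;> first | rfl | (exfalso; push_cast at *; omega)

theorem IsClock.mark {N : ℕ} {T : Tape U.Γ} (hN : 0 < N) (h : IsClock U N N T) :
    IsClock U (N + 1) (N + 1) (PTM.writeMove T (U.bit true, some .right)) := by
  intro i
  simp only [PTM.writeMove, Tape.move_right_nth, Tape.write_nth, h _]
  split_ifs <;> first | rfl | (exfalso; push_cast at *; omega)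

theorem IsClock.move_right {N p : ℕ} {T : Tape U.Γ} (h : IsClock U N p T) :
    IsClock U N (p + 1) (T.move .right) := by
  intro i
  rw [Tape.move_right_nth, h]
  push_cast
  rw [show i + 1 + (p : ℤ) = i + (p + 1) by ring]

theorem IsClock.move_left {N p : ℕ} {T : Tape U.Γ} (h : IsClock U N (p + 1) T) :
    IsClock U N p (T.move .left) := by
  intro i
  rw [Tape.move_left_nth, h]
  push_cast
  rw [show i - 1 + ((p : ℤ) + 1) = i + p by ring]

/-- The number of moves until the head of a clock tape is at its end. -/
def clockDist (N : ℕ) (d : Bool) (p : ℕ) : ℕ := bif d then N - p else p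

theorem IsClock.atEnd_iff {N p : ℕ} {T : Tape U.Γ} (hN : 0 < N) (hp : p ≤ N)
    (h : IsClock U N p T) (d : Bool) : AtEnd U d T.head ↔ clockDist N d p = 0 := by
  have h0 : T.head = _ := h 0
  have hne := U.bit_ne_blank
  have hft : U.bit true ≠ U.bit false := fun h => by simpa using U.bit_injective h
  have hb : (default : U.Γ) ≠ U.bit false := (hne false).symm
  unfold AtEnd clockDist
  rw [h0]
  cases d <;> simp only [zero_add] <;> split_ifs <;> simp_all <;> omega

/-- The number of ticks left on a clock with digits `f` in base `N + 1`. -/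
theorem sum_tick {N : ℕ} : ∀ {c : ℕ} (f g : Fin c → ℕ), (¬ ∀ k, f k = 0) →
    (∀ k, (∀ l < k, f l = 0) → f k = 0 → g k = N) →
    (∀ k, (∀ l < k, f l = 0) → f k ≠ 0 → g k + 1 = f k) →
    (∀ k, (¬ ∀ l < k, f l = 0) → g k = f k) →
    ∑ k, g k * (N + 1) ^ (k : ℕ) + 1 = ∑ k, f k * (N + 1) ^ (k : ℕ)
  | 0, _, _, h, _, _, _ => absurd (fun k => k.elim0) h
  | c + 1, f, g, h, h₁, h₂, h₃ => by
    simp only [Fin.sum_univ_succ, Fin.val_zero, pow_zero, mul_one, Fin.val_succ]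
    have hsplit : ∀ k : Fin c, f 0 = 0 →
        ((∀ l < k.succ, f l = 0) ↔ ∀ l < k, f l.succ = 0) := by
      intro k hf
      constructor
      · exact fun hl l hlk => hl _ (Fin.succ_lt_succ_iff.2 hlk)
      · intro hl l hlk
        induction l using Fin.cases with
        | zero => exact hf
        | succ l => exact hl l (Fin.succ_lt_succ_iff.1 hlk)
    have hpull : ∀ f : Fin (c + 1) → ℕ, ∑ k : Fin c, f k.succ * (N + 1) ^ ((k : ℕ) + 1) =
        (∑ k : Fin c, f k.succ * (N + 1) ^ (k : ℕ)) * (N + 1) := by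
      intro f
      rw [Finset.sum_mul]
      exact Finset.sum_congr rfl fun k _ => by ring
    rw [hpull, hpull]
    -- A zero lowest digit wraps to `N` and passes the tick on to the higher digits; a nonzero one
    -- drops by one and stops the carry.
    by_cases hf : f 0 = 0
    · have hg : g 0 = N := h₁ 0 (fun l hl => absurd hl (Fin.not_lt_zero l)) hf
      have ih := sum_tick (fun k : Fin c => f k.succ) (fun k => g k.succ)
        (fun hk => h fun k => Fin.cases hf hk k)
        (fun k hk => h₁ _ ((hsplit k hf).2 hk)) (fun k hk => h₂ _ ((hsplit k hf).2 hk))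
        (fun k hk => h₃ _ fun hk' => hk ((hsplit k hf).1 hk'))
      rw [← ih, hf, hg]
      ring
    · have hg := h₂ 0 (fun l hl => absurd hl (Fin.not_lt_zero l)) hf
      have hgf : ∀ k : Fin c, g k.succ = f k.succ := fun k =>
        h₃ _ fun hk => hf (hk 0 (Fin.succ_pos k))
      simp only [hgf]
      omega

/-! ### Simulating `U` -/

/-- The digits of the clock are the distances of the heads from their current ends. Reversing the
direction at an end turns digit 0 into digit `N` without rewinding, so each tick takes one step and
can accompany one step of `U`. The function `K` stands for the comparison that follows, which sees
only the output tape. -/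
theorem mcounts_sim (hU : U.Deterministic) {N : ℕ} (hN : 0 < N) {K : Tape U.Γ → ℕ} {t : ℕ} {I : Tape U.Γ}
    (hK : ∀ (W : U.ι → Tape U.Γ) (Z : Fin c → Tape U.Γ),
      MCounts (A := A) t (.inl .cmp) I W Z (K (W U.outputTape))) (R : ℕ) (C : U.Cfg)
    (dir : Fin c → Bool) (pos : Fin c → ℕ) (Z : Fin c → Tape U.Γ) (hpos : ∀ k, pos k ≤ N)
    (hZ : ∀ k, IsClock U N (pos k) (Z k))
    (hR : ∑ k, clockDist N (dir k) (pos k) * (N + 1) ^ (k : ℕ) = R) :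
    MCounts (A := A) (t + R + 1) (.inr (C.state, dir)) I C.tape Z
      (K ((PTM.step^[R] C).tape U.outputTape)) := by
  have hend : ∀ k, AtEnd U (dir k) (Z k).head ↔ clockDist N (dir k) (pos k) = 0 :=
    fun k => (hZ k).atEnd_iff hN (hpos k) _
  induction R generalizing C dir pos Z with
  | zero =>
    have h0 : ∀ k, AtEnd U (dir k) (Z k).head := fun k => (hend k).2 <| by
      have := (Finset.sum_eq_zero_iff.1 hR) k (Finset.mem_univ k)
      simpa using this
    exact mcounts_act (by simp only [countInstr]; rw [if_pos h0]) (PTM.writeMove_self _)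
      (writeMove_keep _) (writeMove_keep _) (hK _ _)
  | succ R ih =>
    have h0 : ¬ ∀ k, AtEnd U (dir k) (Z k).head := by
      intro h
      rw [Finset.sum_eq_zero fun k _ => by rw [(hend k).1 (h k), zero_mul]] at hR
      omega
    set z : Fin c → U.Γ := fun k => (Z k).head
    have hcarry : ∀ k, Carry U dir z k ↔ ∀ l < k, clockDist N (dir l) (pos l) = 0 := fun k =>
      forall₂_congr fun l _ => hend l
    set pos' : Fin c → ℕ := fun k => match tickMove U dir z k with
      | none => pos k
      | some .right => pos k + 1
      | some .left => pos k - 1 with hpos'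
    have hkey : ∀ k, (pos' k ≤ N ∧ IsClock U N (pos' k)
        (PTM.writeMove (Z k) (z k, tickMove U dir z k))) ∧
        ((∀ l < k, clockDist N (dir l) (pos l) = 0) → clockDist N (dir k) (pos k) = 0 →
          clockDist N (tickDir U dir z k) (pos' k) = N) ∧
        ((∀ l < k, clockDist N (dir l) (pos l) = 0) → clockDist N (dir k) (pos k) ≠ 0 →
          clockDist N (tickDir U dir z k) (pos' k) + 1 = clockDist N (dir k) (pos k)) ∧
        ((¬ ∀ l < k, clockDist N (dir l) (pos l) = 0) →
          clockDist N (tickDir U dir z k) (pos' k) = clockDist N (dir k) (pos k)) := by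
      intro k
      have hp := hpos k
      by_cases hc : Carry U dir z k
      · have hc' := (hcarry k).1 hc
        by_cases he : AtEnd U (dir k) (z k)
        · have he' := (hend k).1 he
          have hm : tickMove U dir z k = none := by simp [tickMove, he]
          have hd : tickDir U dir z k = !dir k := by simp [tickDir, hc, he]
          have hp' : pos' k = pos k := by simp only [hpos', hm]
          rw [hm, hd, hp']
          refine ⟨⟨hp, by rw [PTM.writeMove_self]; exact hZ k⟩, fun _ _ => ?_,
            fun _ h => absurd he' h, fun h => absurd hc' h⟩
          cases hdk : dir k <;> simp [clockDist, hdk] at he' ⊢ <;> omega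
        · have he' : ¬ clockDist N (dir k) (pos k) = 0 := fun h => he ((hend k).2 h)
          have hd : tickDir U dir z k = dir k := by simp [tickDir, he]
          cases hdk : dir k
          · have hm : tickMove U dir z k = some .left := by
              rw [tickMove, if_pos ⟨hc, he⟩, hdk]; rfl
            have hp' : pos' k = pos k - 1 := by simp only [hpos', hm]
            simp only [clockDist, hdk, cond_false] at he'
            obtain ⟨p, hpk⟩ : ∃ p, pos k = p + 1 := ⟨pos k - 1, by omega⟩
            rw [hm, hd, hp', hdk]
            refine ⟨⟨by omega, ?_⟩, fun _ h => absurd h he', fun _ _ => ?_,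
              fun h => absurd hc' h⟩
            · rw [PTM.writeMove_self_some, hpk]
              exact IsClock.move_left (hpk ▸ hZ k)
            · simp only [clockDist, cond_false]; omega
          · have hm : tickMove U dir z k = some .right := by
              rw [tickMove, if_pos ⟨hc, he⟩, hdk]; rfl
            have hp' : pos' k = pos k + 1 := by simp only [hpos', hm]
            simp only [clockDist, hdk, cond_true] at he'
            rw [hm, hd, hp', hdk]
            refine ⟨⟨by omega, ?_⟩, fun _ h => absurd h he', fun _ _ => ?_,
              fun h => absurd hc' h⟩
            · rw [PTM.writeMove_self_some]
              exact (hZ k).move_right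
            · simp only [clockDist, cond_true]; omega
      · have hc' : ¬ ∀ l < k, clockDist N (dir l) (pos l) = 0 := fun h => hc ((hcarry k).2 h)
        have hm : tickMove U dir z k = none := by simp [tickMove, hc]
        have hd : tickDir U dir z k = dir k := by simp [tickDir, hc]
        have hp' : pos' k = pos k := by simp only [hpos', hm]
        rw [hm, hd, hp']
        exact ⟨⟨hp, by rw [PTM.writeMove_self]; exact hZ k⟩, fun h => absurd h hc',
          fun h => absurd h hc', fun _ => rfl⟩
    have hsum := sum_tick (N := N) (fun k => clockDist N (dir k) (pos k))
      (fun k => clockDist N (tickDir U dir z k) (pos' k))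
      (fun h => h0 fun k => (hend k).2 (h k)) (fun k => (hkey k).2.1) (fun k => (hkey k).2.2.1)
      (fun k => (hkey k).2.2.2)
    have hnext := fun C' => ih C' (tickDir U dir z) pos' _ (fun k => (hkey k).1.1)
      (fun k => (hkey k).1.2) (by omega)
      (fun k => ((hkey k).1.2).atEnd_iff hN (hkey k).1.1 _)
    rw [Function.iterate_succ_apply]
    rw [show t + (R + 1) + 1 = t + R + 1 + 1 by ring]
    -- Once `U` has halted, its tapes rest while the clock runs on.
    have hhalt : PTM.step C = C → (∀ q b, C.cur ≠ .act q b) →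
        MCounts (A := A) (t + R + 1 + 1) (.inr (C.state, dir)) I C.tape Z
          (K ((PTM.step^[R] (PTM.step C)).tape U.outputTape)) := by
      intro hs hact
      rw [hs]
      refine mcounts_act ?_ (PTM.writeMove_self _) (writeMove_keep _) (fun _ => rfl) (hnext C)
      simp only [countInstr]
      rw [if_neg h0]
      change ∀ q b, U.instr C.state (fun i => (C.tape i).head) ≠ .act q b at hact
      split
      · exact absurd ‹_› (hact _ _)
      · rfl
    match hcur : C.cur with
    | .act q b =>
      have hs : PTM.step C = ⟨q, fun i => PTM.writeMove (C.tape i) (b i)⟩ := by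
        simp [PTM.step, PTM.Cfg.next, hcur]
      rw [hs]
      refine mcounts_act ?_ (PTM.writeMove_self _) (fun _ => rfl) (fun _ => rfl)
        (hnext ⟨q, fun i => PTM.writeMove (C.tape i) (b i)⟩)
      simp only [countInstr]
      rw [if_neg h0]
      change U.instr C.state (fun i => (C.tape i).head) = .act q b at hcur
      rw [hcur]
    | .accept =>
      exact hhalt (by simp [PTM.step, PTM.Cfg.next, hcur]) (by simp [hcur])
    | .reject =>
      exact hhalt (by simp [PTM.step, PTM.Cfg.next, hcur]) (by simp [hcur])
    | .toss q₀ q₁ => exact absurd hcur (hU _ _ _ _)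

end Machine

section Machine

variable {U : PTM} {A c : ℕ}

/-! ### Guessing a program -/

/-- The effect of a coin on the guessed program: leading zeros and the first one are skipped, the
other bits are written from right to left. -/
def guessStep : Option Str → Bool → Option Str
  | none, b => if b then some [] else none
  | some π, b => some (b :: π)

/-- The sum of `K` over the guesses after `n` more coins. -/
def guessSum {β : Type} [Add β] : ℕ → (Option Str → β) → Option Str → β
  | 0, K, s => K s
  | n + 1, K, s => guessSum n K (guessStep s false) + guessSum n K (guessStep s true)

/-- The tapes of `U` during the guessing phase: the head of the input tape is one cell to the left
of the guessed program. -/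
def guessTapes (U : PTM) (s : Option Str) (i : U.ι) : Tape U.Γ :=
  if i = U.inputTape then (Tape.mk₁ ((s.getD []).map U.bit)).move .left else Tape.mk₁ []

theorem mcounts_coin {t : ℕ} {I : Tape U.Γ} {Z : Fin c → Tape U.Γ} {K : Option Str → ℕ}
    (hK : ∀ s, MCounts (A := A) t (.inl (.live s.isSome)) (I.move .right) (guessTapes U s) Z (K s))
    (k : ℕ) (hk : k < A + 1) (s : Option Str) :
    MCounts (A := A) (t + 2 * k + 1) (.inl (.coin ⟨k, hk⟩ s.isSome)) I (guessTapes U s) Z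
      (guessSum k K s) := by
  induction k generalizing s with
  | zero =>
    exact mcounts_act (by simp only [countInstr]) (PTM.writeMove_self_some _ _)
      (writeMove_keep _) (writeMove_keep _) (hK s)
  | succ k ih =>
    cases s with
    | none =>
      have hk' : k < A + 1 := by omega
      have hs := ih hk' (some [])
      -- The leading one is remembered in the control state only; nothing is written for it.
      have : guessTapes U (some []) = guessTapes U none := rfl
      rw [this] at hs
      exact (mcounts_toss rfl (ih hk' none) hs).mono (by omega)
    | some π =>
      have hput : ∀ b, MCounts (A := A) (t + 2 * k + 1 + 1) (.inl (.put ⟨k, by omega⟩ b)) I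
          (guessTapes U (some π)) Z (guessSum k K (some (b :: π))) := by
        intro b
        have hk' : k < A + 1 := by omega
        refine mcounts_act rfl (PTM.writeMove_self _) (fun i => ?_)
          (writeMove_keep _) (ih hk' (some (b :: π)))
        by_cases h : i = U.inputTape
        · simp only [guessTapes, if_pos h]
          exact PTM.writeMove_left_mk₁ _ _
        · simp [guessTapes, if_neg h]
      exact (mcounts_toss (t := t + 2 * k + 1 + 1) (by simp only [countInstr, Option.isSome])
        (hput false) (hput true)).mono (by omega)

theorem mcounts_dummy {t n : ℕ} {I : Tape U.Γ} {W : U.ι → Tape U.Γ} {Z : Fin c → Tape U.Γ}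
    (h : MCounts (A := A) t (.inl .dead) (I.move .right) W Z n) (k : ℕ) (hk : k < A + 1) :
    MCounts (A := A) (t + k + 1) (.inl (.dummy ⟨k, hk⟩)) I W Z (2 ^ k * n) := by
  induction k with
  | zero =>
    rw [pow_zero, one_mul]
    exact mcounts_act (by simp only [countInstr]) (PTM.writeMove_self_some _ _)
      (writeMove_keep _) (writeMove_keep _) h
  | succ k ih =>
    rw [pow_succ', mul_assoc, two_mul]
    exact mcounts_toss (t := t + k + 1) (by simp only [countInstr]) (ih (by omega)) (ih (by omega))

theorem bit_headI_ne_blank (U : PTM) (L : ListBlank U.Γ) (b : Bool) (x : Str) :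
    (Tape.mk' L (ListBlank.mk ((b :: x).map U.bit))).head ≠ default :=
  U.bit_ne_blank b

/-- The remaining coins after the guessing phase has been stopped have no effect. -/
theorem mcounts_dead {t n : ℕ} {W : U.ι → Tape U.Γ} {Z : Fin c → Tape U.Γ} (x l : Str)
    (h : MCounts (A := A) t (.inl .dead)
      (Tape.mk' (ListBlank.mk ((x.reverse ++ l).map U.bit)) (ListBlank.mk [])) W Z n) :
    MCounts (A := A) (t + (A + 2) * x.length) (.inl .dead)
      (Tape.mk' (ListBlank.mk (l.map U.bit)) (ListBlank.mk (x.map U.bit))) W Z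
      (2 ^ ((A + 1) * x.length) * n) := by
  induction x generalizing l with
  | nil => simpa using h
  | cons b x ih =>
    have h' := ih (b :: l) (by simpa using h)
    have hd := mcounts_dummy (I := Tape.mk' (ListBlank.mk (l.map U.bit))
      (ListBlank.mk ((b :: x).map U.bit))) (W := W) (Z := Z) (by simpa using h') A (by omega)
    have := mcounts_toss (q := .inl .dead) (by
      simp only [countInstr]
      rw [if_neg (bit_headI_ne_blank U _ _ _)]; rfl) hd hd
    convert this using 1
    · simp; ring
    · simp; ring

/-! ### Rewinding the input -/

theorem mcounts_back {t n : ℕ} {W : U.ι → Tape U.Γ} {Z : Fin c → Tape U.Γ} (l : Str) :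
    ∀ (R : List U.Γ) (b : Bool), (∀ L, MCounts (A := A) t (.inl .skip)
      (Tape.mk' L (ListBlank.mk (l.reverse.map U.bit ++ U.bit b :: R))) W Z n) →
    MCounts (A := A) (t + l.length + 2) (.inl .back)
      (Tape.mk' (ListBlank.mk (l.map U.bit)) (ListBlank.mk (U.bit b :: R))) W Z n := by
  induction l with
  | nil =>
    intro R b h
    refine mcounts_act (t := t + 1) (by
      simp only [countInstr]; exact if_neg (U.bit_ne_blank b))
        (PTM.writeMove_self_some (Tape.mk' _ (ListBlank.mk (_ :: _))) _)
      (writeMove_keep _) (writeMove_keep _) ?_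
    refine mcounts_act (t := t) (by
      simp only [countInstr]; exact if_pos (by simp)) (PTM.writeMove_self_some _ _)
      (writeMove_keep _) (writeMove_keep _) ?_
    simpa using h (ListBlank.mk [default])
  | cons a l ih =>
    intro R b h
    refine mcounts_act (t := t + l.length + 2) (by
      simp only [countInstr]; exact if_neg (U.bit_ne_blank b))
        (PTM.writeMove_self_some (Tape.mk' _ (ListBlank.mk (_ :: _))) _)
      (writeMove_keep _) (writeMove_keep _) ?_
    simpa using ih (U.bit b :: R) a (by simpa using h)

/-- Skip `1^r 0` on the input tape. -/
def skipOnes : Str → Str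
  | [] => []
  | true :: x => skipOnes x
  | false :: x => x

theorem length_skipOnes_le (x : Str) : (skipOnes x).length ≤ x.length := by
  induction x with
  | nil => simp [skipOnes]
  | cons b x ih => cases b <;> simp [skipOnes]; omega

theorem skipOnes_pairUnary (w : Str) (r : ℕ) : skipOnes (pairUnary w r) = w := by
  induction r with
  | zero => rfl
  | succ r ih => simpa [pairUnary, List.replicate_succ, skipOnes] using ih

theorem mcounts_skip {t n : ℕ} {s : Option Str} {Z : Fin c → Tape U.Γ} (x : Str)
    (L : ListBlank U.Γ)
    (h : ∀ L, MCounts (A := A) t (.inr (U.start, fun _ => false))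
      (Tape.mk' L (ListBlank.mk ((skipOnes x).map U.bit)))
      (U.initial (s.getD [])).tape Z n) :
    MCounts (A := A) (t + x.length + 1) (.inl .skip)
      (Tape.mk' L (ListBlank.mk (x.map U.bit))) (guessTapes U s) Z n := by
  -- On leaving `skip`, the input head of `U` moves from the cell in front of the program to its
  -- first symbol, which produces the initial tapes.
  have hW : ∀ i, PTM.writeMove (guessTapes U s i)
      (moveOnly U.inputTape .right (fun j => (guessTapes U s j).head) i) =
      (U.initial (s.getD [])).tape i := by
    intro i
    by_cases hi : i = U.inputTape <;> simp [moveOnly, guessTapes, PTM.initial, hi]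
  induction x generalizing L with
  | nil =>
    refine mcounts_act (t := t) (by
      simp only [countInstr]; exact if_neg (U.bit_ne_blank true).symm) (PTM.writeMove_self_some (Tape.mk' _ _) _)
      hW (writeMove_keep _) ?_
    simpa [skipOnes] using h _
  | cons b x ih =>
    cases b with
    | false =>
      refine (mcounts_act (t := t) (by
        simp only [countInstr]; exact if_neg (U.bit_injective.ne (by simp)))
        (PTM.writeMove_self_some (Tape.mk' _ (ListBlank.mk (_ :: _))) _)
        hW (writeMove_keep _) ?_).mono (by omega)
      simpa [skipOnes] using h _
    | true =>
      refine mcounts_act (t := t + x.length + 1) (by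
        simp only [countInstr]; exact if_pos rfl)
        (PTM.writeMove_self_some (Tape.mk' _ (ListBlank.mk (_ :: _))) _)
        (writeMove_keep _) (writeMove_keep _) ?_
      simpa using ih _ h

/-! ### The number of accepting paths -/

/-- The output tape of `U` on a program after `(j + 2) ^ c - 1` steps. -/
noncomputable def outTape (U : PTM) (c j : ℕ) (π : Str) : Tape U.Γ :=
  (PTM.step^[(j + 2) ^ c - 1] (U.initial π)).tape U.outputTape

/-- The contribution of a guess with `j` live rounds. -/
noncomputable def guessWeight (U : PTM) (c : ℕ) (w : Str) (j : ℕ) (s : Option Str) : ℕ :=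
  weight U (outTape U c j (s.getD [])) w

/-- The number of accepting paths when `m` symbols of the input remain and `j` rounds have been
live. -/
noncomputable def liveCount (U : PTM) (A c : ℕ) (w : Str) : ℕ → ℕ → Option Str → ℕ
  | 0, _, _ => 0
  | m + 1, j, s => 2 ^ (A + (A + 1) * m) * guessWeight U c w j s +
      guessSum A (liveCount U A c w m (j + 1)) s

theorem sum_clockDist_start (c j : ℕ) :
    ∑ k : Fin c, clockDist (j + 1) false (j + 1) * (j + 1 + 1) ^ (k : ℕ) = (j + 2) ^ c - 1 := by
  have := geom_sum_mul_add (j + 1) c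
  simp only [clockDist, cond_false]
  rw [show j + 2 = j + 1 + 1 from rfl, ← Finset.mul_sum, Fin.sum_univ_eq_sum_range (fun k => (j + 1 + 1) ^ k), mul_comm]
  omega

/-- All that happens once the coins of the guessing phase are used up: rewind, skip the precision,
simulate, compare. The clocks have `j + 1` marked cells, hence `j + 2` head positions and base `j +
2`. -/
theorem mcounts_dead_end (hU : U.Deterministic) (j : ℕ) (s : Option Str) (l : Str) (hl : l ≠ [])
    (Z : Fin c → Tape U.Γ) (hZ : ∀ k, IsClock U (j + 1) (j + 1) (Z k)) :
    MCounts (A := A) (5 * (l.length + 1) + (j + 2) ^ c) (.inl .dead)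
      (Tape.mk' (ListBlank.mk (l.map U.bit)) (ListBlank.mk [])) (guessTapes U s) Z
      (guessWeight U c (skipOnes l.reverse) j s) := by
  obtain ⟨b, l, rfl⟩ := List.exists_cons_of_ne_nil hl
  have hx : ((b :: l).reverse).length = l.length + 1 := by simp
  set y := (b :: l).reverse with hy
  have hpow : 0 < (j + 2) ^ c := by positivity
  have hskip : ∀ L, MCounts (A := A) (2 * (l.length + 1) + ((j + 2) ^ c - 1) + 1 + y.length + 1)
      (.inl .skip) (Tape.mk' L (ListBlank.mk (y.map U.bit))) (guessTapes U s) Z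
      (guessWeight U c (skipOnes y) j s) := by
    intro L
    refine mcounts_skip y L fun L => ?_
    exact mcounts_sim hU (N := j + 1) (by omega) (K := fun T => weight U T (skipOnes y))
      (fun W Z => (mcounts_cmp (skipOnes y) L W Z).mono (by
        have := length_skipOnes_le y; omega)) _ (U.initial (s.getD [])) _ (fun _ => j + 1) Z
      (fun _ => le_rfl) hZ (sum_clockDist_start c j)
  have hlen : (b :: l).length = l.length + 1 := rfl
  refine (mcounts_act (by simp only [countInstr]; exact if_pos rfl)
    (PTM.writeMove_self_some (Tape.mk' _ (ListBlank.mk [])) _)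
    (writeMove_keep _) (writeMove_keep _) ?_).mono
    (t := 2 * (l.length + 1) + ((j + 2) ^ c - 1) + 1 + y.length + 1 + l.length + 2 + 1) (by omega)
  have := mcounts_back (A := A) (W := guessTapes U s) (Z := Z) l [] b (by
    simpa [hy] using hskip)
  simpa [hy] using this

/-- While the guess is live, the symbols read, the live rounds and the marks after the first clock
cell are equally many. The first two terms of the time bound depend only on the total input length,
which a round preserves; the last one pays for the round. -/
theorem mcounts_live (hU : U.Deterministic) (u : Str) : ∀ (l : Str) (s : Option Str)
    (Z : Fin c → Tape U.Γ), (∀ k, IsClock U (l.length + 1) (l.length + 1) (Z k)) →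
    MCounts (A := A) (5 * (l.length + u.length + 1) + (l.length + u.length + 2) ^ c +
        (2 * A + 3) * u.length) (.inl (.live s.isSome))
      (Tape.mk' (ListBlank.mk (l.map U.bit)) (ListBlank.mk (u.map U.bit))) (guessTapes U s) Z
      (liveCount U A c (skipOnes (l.reverse ++ u)) u.length l.length s) := by
  induction u with
  | nil =>
    intro l s Z hZ
    -- A guess that is never stopped is discarded.
    exact mcounts_reject (by simp only [countInstr]; exact if_pos rfl) _
  | cons b u ih =>
    intro l s Z hZ
    have hd := mcounts_dead (A := A) (W := guessTapes U s) (Z := Z) u (b :: l)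
      (mcounts_dead_end hU l.length s _ (by simp) Z hZ)
    have hrev : (u.reverse ++ b :: l).reverse = l.reverse ++ b :: u := by simp
    have hlen : (u.reverse ++ b :: l).length = l.length + (u.length + 1) := by simp; omega
    rw [hrev, hlen] at hd
    have hpow : (l.length + 2) ^ c ≤ (l.length + (u.length + 1) + 2) ^ c :=
      Nat.pow_le_pow_left (by omega) c
    have hd' := mcounts_dummy (I := Tape.mk' (ListBlank.mk (l.map U.bit))
      (ListBlank.mk ((b :: u).map U.bit))) (W := guessTapes U s) (Z := Z)
      (by simpa using hd) A (by omega)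
    -- Idle coins: `A` in the round that stops the guess and `A + 1` for each later symbol.
    rw [← mul_assoc, ← pow_add] at hd'
    rw [List.length_cons]
    set E := 5 * (l.length + (u.length + 1) + 1) + (l.length + (u.length + 1) + 2) ^ c with hE
    have hEq : 5 * (l.length + 1 + u.length + 1) + (l.length + 1 + u.length + 2) ^ c = E := by
      rw [hE, show l.length + 1 + u.length = l.length + (u.length + 1) by ring]
    have hc := mcounts_coin (A := A) (t := E + (2 * A + 3) * u.length)
      (I := Tape.mk' (ListBlank.mk (l.map U.bit))
      (ListBlank.mk ((b :: u).map U.bit))) (fun s => by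
        simpa [hEq] using ih (b :: l) s _ fun k => (hZ k).mark (Nat.succ_pos _)) A (by omega) s
    have hm := mcounts_act (q := .inl (.mark s.isSome)) rfl (PTM.writeMove_self _)
      (writeMove_keep _) (fun _ => rfl) hc
    rw [mul_add, mul_one, ← add_assoc]
    refine (mcounts_toss (t := E + (2 * A + 3) * u.length + 2 * A + 2) (by
      simp only [countInstr]; exact if_neg (bit_headI_ne_blank U _ _ _)) (hd'.mono ?_)
      (hm.mono (by omega))).mono (by omega)
    have : (2 * A + 3) * u.length = (A + 2) * u.length + (A + 1) * u.length := by ring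
    omega

theorem sharpP_liveCount (hU : U.Deterministic) (A c : ℕ) :
    SharpP fun x => liveCount U A c (skipOnes x) x.length 0 none := by
  refine ⟨countMachine U A c, 5 * (Polynomial.X + 1) + (Polynomial.X + 2) ^ c +
    Polynomial.C (2 * A + 3) * Polynomial.X + 1, fun x => ?_⟩
  have hlive := mcounts_live (A := A) (c := c) hU x [] none _ fun _ => isClock_one
  have hinit : MCounts (A := A) (c := c) _ (.inl .init) _ (guessTapes U none) _ _ :=
    mcounts_act rfl (PTM.writeMove_self _) (writeMove_keep _) (fun _ => rfl) hlive
  have hT : ((countMachine U A c).initial x).tape =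
      fam (Tape.mk₁ (x.map U.bit)) (guessTapes U none) (fun _ => Tape.mk₁ []) := by
    funext i
    match i with
    | none => rfl
    | some (.inl i) =>
      have : (if i = U.inputTape then (Tape.mk₁ ([] : List U.Γ)).move .left else Tape.mk₁ []) =
          Tape.mk₁ [] := by simp [PTM.move_left_mk₁_nil]
      exact this.symm
    | some (.inr k) => rfl
  have h : PTM.Counts (M := countMachine U A c) _ ((countMachine U A c).initial x) _ :=
    (congrArg (fun T => PTM.Counts (M := countMachine U A c) _ ⟨.inl .init, T⟩ _) hT).mpr hinit
  have h' := h.mono (t' := Polynomial.eval x.length (5 * (Polynomial.X + 1) +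
    (Polynomial.X + 2) ^ c + Polynomial.C (2 * A + 3) * Polynomial.X + 1)) (by simp)
  exact ⟨h'.1, h'.2.symm⟩

end Machine

/-! ### Sums over guesses -/

theorem guessSum_add_rounds {β : Type} [Add β] (m n : ℕ) (K : Option Str → β) (s : Option Str) :
    guessSum (m + n) K s = guessSum m (guessSum n K) s := by
  induction m generalizing s with
  | zero => simp [guessSum]
  | succ m ih => rw [Nat.succ_add]; simp only [guessSum, ih]

theorem cast_guessSum (n : ℕ) (K : Option Str → ℕ) (s : Option Str) :
    ((guessSum n K s : ℕ) : ℝ) = guessSum n (fun s => (K s : ℝ)) s := by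
  induction n generalizing s with
  | zero => rfl
  | succ n ih => simp [guessSum, ih]

theorem guessSum_linear (n m : ℕ) (a : ℕ → ℝ) (K : ℕ → Option Str → ℝ) (s : Option Str) :
    guessSum n (fun s => ∑ i ∈ Finset.range m, a i * K i s) s =
      ∑ i ∈ Finset.range m, a i * guessSum n (K i) s := by
  induction n generalizing s with
  | zero => rfl
  | succ n ih => simp only [guessSum, ih, ← Finset.sum_add_distrib, mul_add]

theorem guessSum_add (n : ℕ) (K K' : Option Str → ℝ) (s : Option Str) :
    guessSum n (fun s => K s + K' s) s = guessSum n K s + guessSum n K' s := by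
  induction n generalizing s with
  | zero => rfl
  | succ n ih => simp only [guessSum, ih]; ring

theorem guessSum_const_mul (n : ℕ) (a : ℝ) (K : Option Str → ℝ) (s : Option Str) :
    guessSum n (fun s => a * K s) s = a * guessSum n K s := by
  induction n generalizing s with
  | zero => rfl
  | succ n ih => simp only [guessSum, ih]; ring

theorem guessSum_nonneg (n : ℕ) {K : Option Str → ℝ} (hK : ∀ s, 0 ≤ K s) (s : Option Str) :
    0 ≤ guessSum n K s := by
  induction n generalizing s with
  | zero => exact hK s
  | succ n ih => exact add_nonneg (ih _) (ih _)

theorem guessSum_le (n : ℕ) {K : Option Str → ℝ} {b : ℝ} (hK : ∀ s, K s ≤ b) (s : Option Str) :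
    guessSum n K s ≤ 2 ^ n * b := by
  induction n generalizing s with
  | zero => simpa [guessSum] using hK s
  | succ n ih =>
    have h₁ := ih (guessStep s false)
    have h₂ := ih (guessStep s true)
    simp only [guessSum, pow_succ]
    linarith

theorem le_guessSum (y : Str) {K : Option Str → ℝ} (hK : ∀ s, 0 ≤ K s) (s : Option Str) :
    K (y.foldl guessStep s) ≤ guessSum y.length K s := by
  induction y generalizing s with
  | nil => exact le_rfl
  | cons b y ih =>
    have h := ih (guessStep s b)
    have h₁ := guessSum_nonneg y.length hK (guessStep s false)
    have h₂ := guessSum_nonneg y.length hK (guessStep s true)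
    simp only [List.foldl_cons, List.length_cons, guessSum]
    cases b <;> linarith

/-- Every program of length less than `n` is among the guesses after `n` coins. -/
theorem exists_foldl_guessStep (π : Str) (n : ℕ) (h : π.length < n) :
    ∃ y : Str, y.length = n ∧ y.foldl guessStep none = some π := by
  have hzeros : ∀ k, (List.replicate k false).foldl guessStep none = none := by
    intro k
    induction k with
    | zero => rfl
    | succ k ih => simpa [List.replicate_succ, guessStep] using ih
  have hbits : ∀ y σ : Str, y.foldl guessStep (some σ) = some (y.reverse ++ σ) := by
    intro y
    induction y with
    | nil => simp
    | cons b y ih => intro σ; simp [guessStep, ih]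
  -- Zeros pad to `n` coins, the one opens the program, and its bits follow in reverse because
  -- `guessStep` prepends.
  refine ⟨List.replicate (n - 1 - π.length) false ++ true :: π.reverse, by simp; omega, ?_⟩
  rw [List.foldl_append, hzeros, List.foldl_cons]
  simp [guessStep, hbits]

/-! ### Capital -/

theorem cellWeight_false_add_true (U : PTM) (a : U.Γ) :
    cellWeight U a false + cellWeight U a true = 2 := by
  have h : U.bit true ≠ U.bit false := U.bit_injective.ne (by simp)
  unfold cellWeight
  split_ifs <;> simp_all

theorem cellWeight_le (U : PTM) (a : U.Γ) (b : Bool) : cellWeight U a b ≤ 2 := by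
  unfold cellWeight
  split_ifs <;> omega

/-- The two factors of the cell at the new bit are 2 and 0, 0 and 2, or 1 and 1, with sum 2 in every
case. -/
theorem weight_append (U : PTM) (w : Str) (T : Tape U.Γ) :
    weight U T (w ++ [false]) + weight U T (w ++ [true]) = 2 * weight U T w := by
  induction w generalizing T with
  | nil => simpa [weight] using cellWeight_false_add_true U _
  | cons b w ih =>
    simp only [List.cons_append, weight, ← mul_add, ih]
    ring

theorem weight_le (U : PTM) (w : Str) (T : Tape U.Γ) : weight U T w ≤ 2 ^ w.length := by
  induction w generalizing T with
  | nil => simp [weight]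
  | cons b w ih =>
    rw [List.length_cons, pow_succ']
    exact Nat.mul_le_mul (cellWeight_le _ _ _) (ih _)

theorem weight_of_shows (U : PTM) (w : Str) (T : Tape U.Γ)
    (h : ∀ (i : ℕ) (h : i < w.length), T.nth (i : ℤ) = U.bit w[i]) :
    weight U T w = 2 ^ w.length := by
  induction w generalizing T with
  | nil => rfl
  | cons b w ih =>
    have h0 : T.head = U.bit b := h 0 (Nat.succ_pos _)
    have := ih (T.move .right) fun i hi => by
      rw [Tape.move_right_nth]
      exact h (i + 1) (Nat.succ_lt_succ hi)
    simp only [weight, this, cellWeight, h0, if_true, List.length_cons]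
    ring

/-! ### The martingale -/

section Martingale

variable (U : PTM) (A c : ℕ)

/-- The part of the capital on `w` that is due to the guesses with `j` live rounds. -/
noncomputable def roundCapital (w : Str) (j : ℕ) : ℝ :=
  guessSum (A * j) (fun s => (guessWeight U c w j s : ℝ)) none / 2 ^ ((A + 1) * j + 1)

/-- The martingale that averages over all guesses. -/
noncomputable def capital (w : Str) : ℝ := ∑' j, roundCapital U A c w j

theorem roundCapital_nonneg (w : Str) (j : ℕ) : 0 ≤ roundCapital U A c w j :=
  div_nonneg (guessSum_nonneg _ (fun _ => Nat.cast_nonneg _) _) (by positivity)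

/-- The `2^(A * j)` coin sequences cancel against the denominator, leaving the weight `2^-(j+1)` of
the scale times the largest possible capital. -/
theorem roundCapital_le (w : Str) (j : ℕ) :
    roundCapital U A c w j ≤ 2 ^ w.length / 2 * (1 / 2) ^ j := by
  have h := guessSum_le (A * j) (K := fun s => (guessWeight U c w j s : ℝ)) (b := 2 ^ w.length)
    (fun s => by exact_mod_cast weight_le U w _) none
  unfold roundCapital
  rw [div_le_iff₀ (by positivity)]
  refine h.trans_eq ?_
  rw [show (A + 1) * j + 1 = A * j + j + 1 by ring, pow_succ, pow_add, one_div, inv_pow]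
  field_simp

theorem summable_roundCapital (w : Str) : Summable (roundCapital U A c w) :=
  Summable.of_nonneg_of_le (roundCapital_nonneg U A c w) (roundCapital_le U A c w)
    ((summable_geometric_of_lt_one (by norm_num) (by norm_num)).mul_left _)

/-- For a fixed guess the tape `outTape` does not involve `w`, so `weight_append` applies term by
term. -/
theorem isMartingale_capital : IsMartingale (capital U A c) := by
  intro w
  refine ⟨tsum_nonneg (roundCapital_nonneg U A c w), ?_⟩
  unfold capital
  rw [← (summable_roundCapital U A c _).tsum_add (summable_roundCapital U A c _), eq_div_iff
    two_ne_zero, ← tsum_mul_right]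
  refine tsum_congr fun j => ?_
  unfold roundCapital
  rw [← add_div, ← guessSum_add, div_mul_eq_mul_div, mul_comm _ (2 : ℝ), ← guessSum_const_mul]
  congr 2
  funext s
  exact_mod_cast (weight_append U w _).symm

/-- The recursion unrolled: the `i`-th term collects the guesses stopped after `i` further live
rounds, and its quotient of powers counts the outcomes of their idle coins. -/
theorem liveCount_eq (w : Str) (m j : ℕ) (s : Option Str) :
    (liveCount U A c w m j s : ℝ) = ∑ i ∈ Finset.range m,
      2 ^ ((A + 1) * m) / 2 ^ ((A + 1) * i + 1) *
        guessSum (A * i) (fun s => (guessWeight U c w (j + i) s : ℝ)) s := by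
  induction m generalizing j s with
  | zero => simp [liveCount]
  | succ m ih =>
    -- The term `i = 0`, a guess stopped in this very round, is split off.
    rw [Finset.sum_range_succ', liveCount]
    push_cast
    rw [cast_guessSum, add_comm]
    congr 1
    · simp only [ih]
      rw [guessSum_linear]
      refine Finset.sum_congr rfl fun i _ => ?_
      rw [← guessSum_add_rounds, show A + A * i = A * (i + 1) by ring,
        show j + 1 + i = j + (i + 1) by ring]
      congr 1
      rw [div_eq_div_iff (by positivity) (by positivity), ← pow_add, ← pow_add]
      congr 1
      ring
    · simp only [mul_zero, zero_add, pow_one, guessSum, add_zero]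
      congr 1
      rw [eq_div_iff two_ne_zero, ← pow_succ]
      congr 1
      ring

theorem liveCount_div_eq (w : Str) (m : ℕ) :
    (liveCount U A c w m 0 none : ℝ) / 2 ^ ((A + 1) * m) =
      ∑ i ∈ Finset.range m, roundCapital U A c w i := by
  rw [liveCount_eq, Finset.sum_div]
  refine Finset.sum_congr rfl fun i _ => ?_
  rw [roundCapital, zero_add]
  field_simp

theorem abs_capital_sub_le (w : Str) (m : ℕ) :
    |capital U A c w - ∑ i ∈ Finset.range m, roundCapital U A c w i| ≤
      2 ^ w.length * (1 / 2) ^ m := by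
  have hs := summable_roundCapital U A c w
  have h := hs.sum_add_tsum_nat_add m
  have hle : ∑' i, roundCapital U A c w (i + m) ≤
      ∑' i, 2 ^ w.length / 2 * (1 / 2) ^ m * (1 / 2 : ℝ) ^ i := by
    refine Summable.tsum_le_tsum (fun i => (roundCapital_le U A c w (i + m)).trans_eq ?_)
      ((summable_nat_add_iff m).2 hs)
      ((summable_geometric_of_lt_one (by norm_num) (by norm_num)).mul_left _)
    rw [pow_add]
    ring
  rw [tsum_mul_left, tsum_geometric_two] at hle
  have h0 : 0 ≤ ∑' i, roundCapital U A c w (i + m) :=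
    tsum_nonneg fun i => roundCapital_nonneg U A c w _
  unfold capital
  rw [← h, add_sub_cancel_left, abs_of_nonneg h0]
  linarith

theorem isSharpPMartingale_capital (hU : U.Deterministic) :
    IsSharpPMartingale (capital U A c) := by
  refine ⟨isMartingale_capital U A c, _, _, sharpP_liveCount hU A c, fp_two_pow (A + 1),
    fun w r => ⟨⟨_, rfl⟩, ?_⟩⟩
  have hlen : (pairUnary w r).length = r + 1 + w.length := by simp [pairUnary]; ring
  rw [skipOnes_pairUnary]
  push_cast
  rw [liveCount_div_eq, hlen]
  -- The input length contains `|w|`, which absorbs the factor `2^|w|`: the error is at most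
  -- `2^-(r+1)`.
  refine (abs_capital_sub_le U A c w _).trans ?_
  rw [pow_add, pow_add, one_div, inv_pow _ w.length]
  have : (0 : ℝ) < 2⁻¹ ^ r := by positivity
  field_simp
  norm_num

/-- All terms are nonnegative, so the single coin sequence coding `π` at scale `j` already bounds
the capital from below. -/
theorem pow_le_capital (hU : U.Deterministic) {x π : Str} {t j : ℕ}
    (h : PTM.PrintsWithin t (U.initial π) x) (ht : t ≤ (j + 2) ^ c - 1) (hπ : π.length < A * j) :
    (2 : ℝ) ^ x.length ≤ capital U A c x * 2 ^ ((A + 1) * j + 1) := by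
  have hshow := PTM.shows_iterate_step hU h ht
  have hw : guessWeight U c x j (some π) = 2 ^ x.length := weight_of_shows U x _ hshow.1
  obtain ⟨y, hy, hfold⟩ := exists_foldl_guessStep π (A * j) hπ
  have h₁ := le_guessSum y (K := fun s => (guessWeight U c x j s : ℝ))
    (fun _ => Nat.cast_nonneg _) none
  rw [hfold, hw, hy] at h₁
  have h₂ : roundCapital U A c x j ≤ capital U A c x :=
    (summable_roundCapital U A c x).le_tsum j fun i _ => roundCapital_nonneg U A c x i
  rw [roundCapital, div_le_iff₀ (by positivity)] at h₂
  push_cast at h₁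
  exact h₁.trans h₂

end Martingale

/-! ### Polynomial bounds -/

theorem exists_eval_lt_pow (q : Polynomial ℕ) : ∃ c : ℕ, ∀ j : ℕ, q.eval j < (j + 2) ^ c := by
  induction q using Polynomial.induction_on' with
  | add q₁ q₂ h₁ h₂ =>
    obtain ⟨c₁, h₁⟩ := h₁
    obtain ⟨c₂, h₂⟩ := h₂
    refine ⟨max c₁ c₂ + 1, fun j => ?_⟩
    have e₁ : (j + 2) ^ c₁ ≤ (j + 2) ^ max c₁ c₂ :=
      Nat.pow_le_pow_right (by omega) (le_max_left _ _)
    have e₂ : (j + 2) ^ c₂ ≤ (j + 2) ^ max c₁ c₂ :=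
      Nat.pow_le_pow_right (by omega) (le_max_right _ _)
    rw [Polynomial.eval_add, pow_succ]
    have := h₁ j
    have := h₂ j
    -- The base is at least 2, so one more factor absorbs the sum of two bounds.
    have : (j + 2) ^ max c₁ c₂ * 2 ≤ (j + 2) ^ max c₁ c₂ * (j + 2) :=
      Nat.mul_le_mul_left _ (by omega)
    omega
  | monomial n a =>
    refine ⟨a + n, fun j => ?_⟩
    rw [Polynomial.eval_monomial, pow_add]
    calc a * j ^ n ≤ a * (j + 2) ^ n := by gcongr; omega
      _ < (j + 2) ^ a * (j + 2) ^ n := by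
        gcongr
        exact Nat.lt_two_pow_self.trans_le (Nat.pow_le_pow_left (by omega) a)

theorem eval_le_eval_nat (p : Polynomial ℕ) {m n : ℕ} (h : m ≤ n) : p.eval m ≤ p.eval n := by
  simp only [Polynomial.eval_eq_sum, Polynomial.sum]
  gcongr

/-- For all `A`, `B > 0` and every polynomial time bound `p` there is a `#P`-martingale that wins
on all strings of length `n` with programs of length less than `(A / B) n`. -/
theorem exists_sharpPMartingale {U : PTM} (hU : U.Deterministic) (p : Polynomial ℕ) (A : ℕ) {B : ℕ}
    (hB : 0 < B) : ∃ d, IsSharpPMartingale d ∧ ∀ x π : Str,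
      PTM.PrintsWithin (p.eval x.length) (U.initial π) x → π.length * B < A * x.length →
      (2 : ℝ) ^ x.length ≤ d x * 2 ^ ((A + 1) * (x.length / B + 1) + 1) := by
  -- At scale `j = |x| / B + 1` one has `|x| < B * j`, so time `p(B * j)` suffices; strictness
  -- leaves room for the `- 1` in the clock.
  obtain ⟨c, hc⟩ := exists_eval_lt_pow (p.comp (Polynomial.C B * Polynomial.X))
  refine ⟨capital U A c, isSharpPMartingale_capital U A c hU, fun x π h hπ => ?_⟩
  have hlt : x.length < B * (x.length / B + 1) := Nat.lt_mul_div_succ _ hB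
  refine pow_le_capital U A c hU h ?_ ?_
  · have h₁ := hc (x.length / B + 1)
    have h₂ := eval_le_eval_nat p hlt.le
    simp only [Polynomial.eval_comp, Polynomial.eval_mul, Polynomial.eval_C, Polynomial.eval_X]
      at h₁
    omega
  · refine Nat.lt_of_mul_lt_mul_right (a := B) (hπ.trans_le ?_)
    calc A * x.length ≤ A * (B * (x.length / B + 1)) := Nat.mul_le_mul_left _ hlt.le
      _ = A * (x.length / B + 1) * B := by ring

/-! ### From complexity rates to dimension. -/

theorem exists_program_of_timeK_div_lt {U : PTM} {t : ℕ → ℕ} {x : Str} {k : ℝ≥0}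
    (h : ((timeK U t x : ℕ∞) : ℝ≥0∞) / (x.length : ℝ≥0∞) < k) (hx : 0 < x.length) :
    ∃ π, PTM.PrintsWithin (t x.length) (U.initial π) x ∧ (π.length : ℝ) < k * x.length := by
  rw [ENNReal.div_lt_iff (Or.inl (by exact_mod_cast hx.ne')) (Or.inl (by simp))] at h
  have hfin : timeK U t x ≠ ⊤ := by
    rintro hT
    simp [hT] at h
  obtain ⟨m, hm⟩ := ENat.ne_top_iff_exists.1 hfin
  rw [← hm] at h
  have hlt : timeK U t x < ((m + 1 : ℕ) : ℕ∞) := by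
    rw [← hm]; exact_mod_cast Nat.lt_succ_self m
  simp only [timeK, iInf_lt_iff] at hlt
  obtain ⟨π, hπ, hlen⟩ := hlt
  refine ⟨π, hπ, ?_⟩
  have h₁ : π.length ≤ m := by
    have : π.length < m + 1 := by exact_mod_cast hlen
    omega
  have h₂ : ((m : ℝ≥0) : ℝ≥0∞) < ((k * x.length : ℝ≥0) : ℝ≥0∞) := by
    push_cast
    simpa using h
  have h₃ : (m : ℝ≥0) < k * x.length := ENNReal.coe_lt_coe.1 h₂
  exact lt_of_le_of_lt (by exact_mod_cast h₁)
    (show (m : ℝ) < k * x.length from by exact_mod_cast h₃)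

/-- The common core of both inequalities. -/
theorem exists_sharpPMartingale_rate {U : PTM} (hU : U.Deterministic) (p : Polynomial ℕ)
    {k s : ℝ≥0} (hks : k < s) : ∃ d, IsSharpPMartingale d ∧ ∀ S : ℕ → Bool, ∀ᶠ n : ℕ in atTop,
      ((timeK U (fun m => p.eval m) (pre S n) : ℕ∞) : ℝ≥0∞) / (n : ℝ≥0∞) < k →
      (2 : ℝ) ^ ((1 - (s : ℝ)) * (n : ℝ)) ≤ d (pre S n) := by
  have hks' : (0 : ℝ) < s - k := sub_pos.2 hks
  -- The loss per symbol is about `(A + 1) / B`, and `A ≤ k * B + 1` makes this at most `k + 2 / B <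
  -- s`.
  obtain ⟨B, hB⟩ := exists_nat_gt (2 / ((s : ℝ) - k))
  have hB0 : (0 : ℝ) < B := lt_trans (by positivity) hB
  have hB0' : 0 < B := by exact_mod_cast hB0
  rw [div_lt_iff₀ hks'] at hB
  set A := ⌊(k : ℝ) * B⌋₊ + 1 with hA
  have hA₁ : (k : ℝ) * B < A := by rw [hA]; push_cast; exact Nat.lt_floor_add_one _
  have hA₂ : (A : ℝ) ≤ k * B + 1 := by
    rw [hA]; push_cast
    linarith [Nat.floor_le (show (0 : ℝ) ≤ k * B by positivity)]
  obtain ⟨d, hd, hwin⟩ := exists_sharpPMartingale hU p A hB0'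
  refine ⟨d, hd, fun S => ?_⟩
  -- The gain `n * δ` eventually exceeds `(A + 2) * B`, the cost of the rounded-up scale and of the
  -- stopping coin.
  set δ : ℝ := s * B - (A + 1) with hδ
  have hδ0 : 0 < δ := by rw [hδ]; nlinarith
  filter_upwards [eventually_gt_atTop 0, eventually_ge_atTop ⌈((A + 2) * B : ℝ) / δ⌉₊]
    with n hn hnbig hK
  have hlen : (pre S n).length = n := by simp [pre]
  have hnbig' : ((A + 2) * B : ℝ) ≤ n * δ := (div_le_iff₀ hδ0).1 (Nat.ceil_le.1 hnbig)
  obtain ⟨π, hπ, hπlen⟩ := exists_program_of_timeK_div_lt (x := pre S n)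
    (by rw [hlen]; exact hK) (by omega)
  have hn0 : (0 : ℝ) < n := by exact_mod_cast hn
  have hcmp : π.length * B < A * (pre S n).length := by
    rw [hlen] at hπlen ⊢
    have : (π.length : ℝ) * B < A * n := by
      calc (π.length : ℝ) * B < k * n * B := by gcongr
        _ = k * B * n := by ring
        _ < A * n := by gcongr
    exact_mod_cast this
  have h := hwin _ π hπ hcmp
  rw [hlen] at h
  set e := (A + 1) * (n / B + 1) + 1 with he
  have hdiv : ((n / B : ℕ) : ℝ) ≤ n / B := Nat.cast_div_le
  have he' : (e : ℝ) ≤ s * n := by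
    have h₁ : (e : ℝ) ≤ (A + 1) * (n / B + 1) + 1 := by
      rw [he]; push_cast; gcongr
    refine h₁.trans ?_
    have h₂ : ((A + 1) * (n / B + 1) + 1 : ℝ) = ((A + 1) * n + (A + 2) * B) / B := by
      field_simp; ring
    rw [h₂, div_le_iff₀ hB0]
    calc ((A + 1) * n + (A + 2) * B : ℝ) ≤ (A + 1) * n + n * δ := by gcongr
      _ = s * n * B := by rw [hδ]; ring
  have h2e : (0 : ℝ) < 2 ^ e := by positivity
  rw [← div_le_iff₀ h2e] at h
  refine le_trans ?_ h
  rw [le_div_iff₀ h2e, ← Real.rpow_natCast, ← Real.rpow_natCast,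
    ← Real.rpow_add (by norm_num)]
  exact Real.rpow_le_rpow_of_exponent_le (by norm_num) (by linarith)

theorem sharpPDim_le_polyKRate (U : PTM) (hU : U.Deterministic) (X : Set (ℕ → Bool)) :
    sharpPDim X ≤ polyKRate U X := by
  refine le_iInf fun p => le_of_not_gt fun hlt => ?_
  obtain ⟨s, hs, hdim⟩ := ENNReal.lt_iff_exists_nnreal_btwn.1 hlt
  -- The rate lies below `k < s`, so `s` is positive and the clause for `s = 0` in `Succeeds` never
  -- arises.
  obtain ⟨k, hk, hks⟩ := ENNReal.lt_iff_exists_nnreal_btwn.1 hs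
  have hks' : k < s := by exact_mod_cast hks
  obtain ⟨d, hd, hwin⟩ := exists_sharpPMartingale_rate hU p hks'
  refine hdim.not_ge (iInf₂_le s ⟨d, hd, fun S hS => Or.inl ⟨?_, ?_⟩⟩)
  · exact_mod_cast pos_of_gt hks'
  · have := frequently_lt_of_liminf_lt (by isBoundedDefault)
      ((le_iSup₂ (f := fun S (_ : S ∈ X) => liminf (fun n : ℕ =>
        ((timeK U (fun m => p.eval m) (pre S n) : ℕ∞) : ℝ≥0∞) / (n : ℝ≥0∞)) atTop) S hS).trans_lt hk)
    exact (this.and_eventually (hwin S)).mono fun n hn => hn.2 hn.1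

theorem sharpPStrongDim_le_polyKStrongRate (U : PTM) (hU : U.Deterministic)
    (X : Set (ℕ → Bool)) : sharpPStrongDim X ≤ polyKStrongRate U X := by
  refine le_iInf fun p => le_of_not_gt fun hlt => ?_
  obtain ⟨s, hs, hdim⟩ := ENNReal.lt_iff_exists_nnreal_btwn.1 hlt
  obtain ⟨k, hk, hks⟩ := ENNReal.lt_iff_exists_nnreal_btwn.1 hs
  have hks' : k < s := by exact_mod_cast hks
  obtain ⟨d, hd, hwin⟩ := exists_sharpPMartingale_rate hU p hks'
  refine hdim.not_ge (iInf₂_le s ⟨d, hd, fun S hS => Or.inl ⟨?_, ?_⟩⟩)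
  · exact_mod_cast pos_of_gt hks'
  · have := eventually_lt_of_limsup_lt
      ((le_iSup₂ (f := fun S (_ : S ∈ X) => limsup (fun n : ℕ =>
        ((timeK U (fun m => p.eval m) (pre S n) : ℕ∞) : ℝ≥0∞) / (n : ℝ≥0∞)) atTop) S hS).trans_lt hk)
      (by isBoundedDefault)
    exact (this.and (hwin S)).mono fun n hn => hn.2 hn.1

end CountingDim

/-- The inequalities hold for every deterministic reference machine `U`, in particular for every
universal one, for which the right-hand sides are the usual Kolmogorov complexity rates. -/
theorem mainTheorem11 (U : CountingDim.PTM) (hU : U.Deterministic) (X : Set (ℕ → Bool)) :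
    CountingDim.sharpPDim X ≤ CountingDim.polyKRate U X ∧
      CountingDim.sharpPStrongDim X ≤ CountingDim.polyKStrongRate U X :=
  ⟨CountingDim.sharpPDim_le_polyKRate U hU X, CountingDim.sharpPStrongDim_le_polyKStrongRate U hU X⟩
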